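/- Let $v:\mathbb R^3\to\mathbb R^3$ and $p,\lambda:\mathbb R^3\to\mathbb R$, and let $(v,p)$ be a Beltrami solution of the stationary Euler equations with factor $\lambda$. This means that $v\in L^2_{loc}(\mathbb R^3)$, $p\in L^1_{loc}(\mathbb R^3)$ and $\lambda v\in L^1_{loc}(\mathbb R^3)$; that $(v,p)$ solves the stationary Euler equations $$\sum_{j=1}^3\partial_j(v_iv_j)+\partial_i p=0\quad (i=1,2,3),\qquad \operatorname{div} v=0$$ in the sense of distributions; that $\operatorname{curl} v=\lambda v$ in the sense of distributions; and that $p+\frac12|v|^2$ is almost everywhere equal to a constant. (If $v$ is of class $C^1$, the first Euler equation follows from the other conditions.) Then: 1. If $v\in L^2(\mathbb R^3)$, then $v=0$ almost everywhere. 2. The same conclusion holds if there is $q\in[\frac65,\infty]$ such that $v\in L^q(\mathbb R^3)$ and $\lambda\in L^{\frac{6q}{5q-6}}(\mathbb R^3)$, where the exponent $\frac{6q}{5q-6}$ is read as $\infty$ for $q=\frac65$ and as $\frac65$ for $q=\infty$, and where in the case $q=\infty$ it is also assumed that $v$ vanishes at infinity, in the sense that the set $\{x:|v(x)|>\varepsilon\}$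 has finite Lebesgue measure for every $\varepsilon>0$. -/

import Mathlib

open MeasureTheory
open scoped ENNReal

namespace Beltrami

/-- Three-dimensional Euclidean space. -/
abbrev E3 : Type := EuclideanSpace ℝ (Fin 3)

/-- The partial derivative `∂ⱼ φ` of a scalar function on `ℝ³`. -/
noncomputable def pd (j : Fin 3) (φ : E3 → ℝ) (x : E3) : ℝ :=
  fderiv ℝ φ x (EuclideanSpace.single j 1)

/-- Test functions: real-valued, smooth and compactly supported on `ℝ³`. -/
structure IsTest (φ : E3 → ℝ) : Prop where
  smooth : ContDiff ℝ (⊤ : ℕ∞) φ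
  compact : HasCompactSupport φ

/-- `v ∈ L²_loc(ℝ³; ℝ³)`: measurable up to a null set and square integrable on compact sets. -/
structure IsL2Loc (v : E3 → E3) : Prop where
  meas : AEStronglyMeasurable v volume
  loc : ∀ K : Set E3, IsCompact K → MemLp v 2 (volume.restrict K)

/-- `div v = 0` in the sense of distributions. -/
def WeakDivFree (v : E3 → E3) : Prop :=
  ∀ φ : E3 → ℝ, IsTest φ → ∫ x, ∑ j, v x j * pd j φ x = 0

/-- `curl v = w` in the sense of distributions, where `w` is locally integrable.
The indices are modulo `3`, so that component `i` of the curl is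
`∂ᵢ₊₁ vᵢ₊₂ - ∂ᵢ₊₂ vᵢ₊₁`; the derivatives are moved to the test function. -/
structure HasWeakCurl (v w : E3 → E3) : Prop where
  locInt : LocallyIntegrable w volume
  eq : ∀ φ : E3 → ℝ, IsTest φ → ∀ i : Fin 3,
    ∫ x, (v x (i + 1) * pd (i + 2) φ x - v x (i + 2) * pd (i + 1) φ x) = ∫ x, w x i * φ x

/-- `(v, p)` is a weak solution of the stationary Euler equations
`(v · ∇) v = - ∇ p`, `div v = 0` in `ℝ³`; the first equation is used in the form
`∑ⱼ ∂ⱼ (vᵢ vⱼ) + ∂ᵢ p = 0`. -/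
structure IsStationaryEuler (v : E3 → E3) (p : E3 → ℝ) : Prop where
  l2loc : IsL2Loc v
  p_locInt : LocallyIntegrable p volume
  div_free : WeakDivFree v
  momentum : ∀ φ : E3 → ℝ, IsTest φ → ∀ i : Fin 3,
    ∫ x, ((∑ j, v x i * v x j * pd j φ x) + p x * pd i φ x) = 0

/-- `(v, p)` is a Beltrami solution of the stationary Euler equations with the factor `lam`:
a solution with `curl v = lam v` and `p + |v|² / 2` constant. -/
structure IsBeltramiSolution (v : E3 → E3) (p lam : E3 → ℝ) : Prop where
  euler : IsStationaryEuler v p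
  curl_eq : HasWeakCurl v (fun x => lam x • v x)
  bernoulli : ∃ c : ℝ, ∀ᵐ x, p x + ‖v x‖ ^ 2 / 2 = c

/-- The exponent `6 q / (5 q - 6)` for `6/5 ≤ q ≤ ∞`, with value `6/5` at `q = ∞`.
At `q = 6/5` the denominator is `0` and the value is `∞`. -/
noncomputable def factorExponent (q : ℝ≥0∞) : ℝ≥0∞ :=
  if q = ∞ then 6 / 5 else 6 * q / (5 * q - 6)

/-- `v` vanishes at infinity (in the measure sense): `{|v| > ε}` has finite measure
for every `ε > 0`. -/
def VanishesAtInfinity (v : E3 → E3) : Prop :=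
  ∀ ε : ℝ, 0 < ε → volume {x | ε < ‖v x‖} < ∞

end Beltrami

namespace Beltrami

open Filter Topology Convolution


/-! Finite energy forces `v = 0` by a Pohozaev-type identity. Bernoulli's law turns the momentum
equation into `div (v ⊗ v - |v|²/2 · I) = 0`. Testing this against a truncation of the position
field, which is permitted in the limit because `|v|²` is integrable, gives `∫ (v_i² - |v|²/2) = 0`
for each `i`. Summing over three coordinates gives `-½ ∫ |v|² = 0`
(`IsBeltramiSolution.ae_eq_zero_of_memLp_two`).

The integrability condition on `λ` reduces to this case. By Hölder the curl `w = λv` lies in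
`L^{6/5}`, so it remains to see that a divergence free field that vanishes at infinity, with curl in
`L^{6/5}`, lies in `L²` (`memLp_two_of_curl`). Formally `-Δv = curl w`, so `v` is `w` convolved with
the gradient of the Newtonian kernel. In place of that singular kernel stand test functions `G` with
`ΔG = k_R - k_r`, where `k` is a mollifier (`exists_mollifier`). Then `v * ΔG` is a combination of
terms `w * ∂G`, bounded in `L²` by an energy estimate that sees only `‖ΔG‖₁` (`eLpNorm_conv_pd_le`).
As `r → 0` and `R → ∞`, `v * ΔG → -v` almost everywhere, and Fatou's lemma transfers the bound to
`v`. -/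

/-! ### Test functions, convolutions and the weak identity for the Laplacian -/

/-- The Laplacian `∑ⱼ ∂ⱼ∂ⱼ φ` of a scalar function on `ℝ³`. -/
noncomputable def lap (φ : E3 → ℝ) (x : E3) : ℝ := ∑ j, pd j (pd j φ) x

lemma contDiff_pd {φ : E3 → ℝ} (h : ContDiff ℝ (⊤ : ℕ∞) φ) (j : Fin 3) :
    ContDiff ℝ (⊤ : ℕ∞) (pd j φ) :=
  (h.fderiv_right (m := (⊤ : ℕ∞)) (by simp)).clm_apply contDiff_const

lemma IsTest.pd {φ : E3 → ℝ} (h : IsTest φ) (j : Fin 3) : IsTest (pd j φ) :=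
  ⟨contDiff_pd h.smooth j, h.compact.fderiv_apply ℝ _⟩

lemma IsTest.continuous {φ : E3 → ℝ} (h : IsTest φ) : Continuous φ := h.smooth.continuous

lemma continuous_lap {φ : E3 → ℝ} (h : ContDiff ℝ (⊤ : ℕ∞) φ) : Continuous (lap φ) :=
  continuous_finsetSum _ fun j _ => (contDiff_pd (contDiff_pd h j) j).continuous

/-- A locally integrable function is integrable against a continuous compactly supported one. -/
lemma integrable_mul_of_hasCompactSupport {f g : E3 → ℝ} (hf : LocallyIntegrable f volume)
    (hg : Continuous g) (hc : HasCompactSupport g) : Integrable (fun x => f x * g x) := by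
  simpa [mul_comm] using hf.integrable_smul_left_of_hasCompactSupport hg hc

lemma pd_pd_comm {φ : E3 → ℝ} (h : ContDiff ℝ (⊤ : ℕ∞) φ) (i j : Fin 3) (x : E3) :
    pd i (pd j φ) x = pd j (pd i φ) x := by
  have hd : DifferentiableAt ℝ (fderiv ℝ φ) x :=
    ((h.fderiv_right (m := (⊤ : ℕ∞)) (by simp)).differentiable (by simp)) x
  have key : ∀ a b : Fin 3, pd a (pd b φ) x =
      fderiv ℝ (fderiv ℝ φ) x (EuclideanSpace.single a 1) (EuclideanSpace.single b 1) := by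
    intro a b
    unfold pd
    rw [fderiv_clm_apply hd (differentiableAt_const _)]
    simp
  rw [key, key]
  exact (h.contDiffAt.isSymmSndFDerivAt
    (by
      simp only [minSmoothness_of_isRCLikeNormedField]
      exact WithTop.coe_le_coe.2 (le_top : (2 : ℕ∞) ≤ ⊤))) _ _

/-- Derivative of a function composed with an affine map `x ↦ a + c x`. -/
lemma pd_comp_affine {φ : E3 → ℝ} (h : Differentiable ℝ φ) (a : E3) (c : ℝ) (j : Fin 3) (x : E3) :
    pd j (fun y => φ (a + c • y)) x = c * pd j φ (a + c • x) := by
  have h1 : HasFDerivAt (fun y : E3 => a + c • y) (c • ContinuousLinearMap.id ℝ E3) x :=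
    ((hasFDerivAt_id x).const_smul c).const_add a
  have h2 := (h (a + c • x)).hasFDerivAt.comp x h1
  unfold pd
  rw [show (fun y => φ (a + c • y)) = φ ∘ fun y => a + c • y from rfl, h2.fderiv]
  simp

lemma IsTest.reflect {φ : E3 → ℝ} (h : IsTest φ) (x : E3) : IsTest (fun y => φ (x - y)) := by
  refine ⟨h.smooth.comp (contDiff_const.sub contDiff_id), ?_⟩
  exact h.compact.comp_homeomorph (Homeomorph.subLeft x)

lemma pd_reflect {φ : E3 → ℝ} (h : Differentiable ℝ φ) (x : E3) (j : Fin 3) (y : E3) :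
    pd j (fun y => φ (x - y)) y = - pd j φ (x - y) := by
  have := pd_comp_affine h x (-1) j y
  simpa [sub_eq_add_neg] using this

lemma lap_reflect {φ : E3 → ℝ} (h : ContDiff ℝ (⊤ : ℕ∞) φ) (x y : E3) :
    lap (fun y => φ (x - y)) y = lap φ (x - y) := by
  unfold lap
  refine Finset.sum_congr rfl fun j _ => ?_
  have h1 : pd j (fun y => φ (x - y)) = fun y => (fun z => - pd j φ z) (x - y) := by
    ext y; exact pd_reflect (h.differentiable (by simp)) x j y
  have hd := (contDiff_pd h j).differentiable (n := (⊤ : ℕ∞)) (by simp)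
  rw [h1, pd_reflect hd.fun_neg]
  unfold pd at hd ⊢
  rw [fderiv_fun_neg]
  simp

/-- The convolution `∫ f(t) g(x - t) dt` of scalar functions. -/
noncomputable def conv (f g : E3 → ℝ) : E3 → ℝ := f ⋆[ContinuousLinearMap.mul ℝ ℝ, volume] g

lemma conv_apply (f g : E3 → ℝ) (x : E3) : conv f g x = ∫ t, f t * g (x - t) := rfl

lemma conv_apply_swap (f g : E3 → ℝ) (x : E3) : conv f g x = ∫ t, f (x - t) * g t :=
  convolution_mul_swap

lemma conv_integrand_integrable {f g : E3 → ℝ} (hf : LocallyIntegrable f volume)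
    (hg : Continuous g) (hc : HasCompactSupport g) (x : E3) :
    Integrable (fun t => f t * g (x - t)) :=
  integrable_mul_of_hasCompactSupport hf (hg.comp (continuous_const.sub continuous_id))
    (hc.comp_homeomorph (Homeomorph.subLeft x))

lemma contDiff_conv {f g : E3 → ℝ} (hf : LocallyIntegrable f volume) (hg : IsTest g) :
    ContDiff ℝ (⊤ : ℕ∞) (conv f g) :=
  hg.compact.contDiff_convolution_right _ hf hg.smooth

lemma isTest_conv {f g : E3 → ℝ} (hf : LocallyIntegrable f volume) (hfc : HasCompactSupport f)
    (hg : IsTest g) : IsTest (conv f g) :=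
  ⟨contDiff_conv hf hg, hfc.convolution _ hg.compact⟩

lemma pd_conv {f g : E3 → ℝ} (hf : LocallyIntegrable f volume) (hg : IsTest g) (j : Fin 3) :
    pd j (conv f g) = conv f (pd j g) := by
  ext x
  have h1 : ContDiff ℝ 1 g := hg.smooth.of_le (by exact_mod_cast le_top)
  unfold pd conv
  rw [(hg.compact.hasFDerivAt_convolution_right (ContinuousLinearMap.mul ℝ ℝ) hf h1 x).fderiv,
    convolution_precompR_apply _ hf (hg.compact.fderiv ℝ) (h1.continuous_fderiv one_ne_zero)]

lemma lap_conv {f g : E3 → ℝ} (hf : LocallyIntegrable f volume) (hg : IsTest g) :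
    lap (conv f g) = conv f (lap g) := by
  ext x
  simp only [lap, pd_conv hf hg, pd_conv hf (hg.pd _)]
  simp only [conv_apply]
  rw [← integral_finsetSum]
  · simp [lap, Finset.mul_sum]
  · intro j _
    exact conv_integrand_integrable hf ((hg.pd j).pd j).continuous ((hg.pd j).pd j).compact x

lemma locallyIntegrable_component {u : E3 → E3} (hu : LocallyIntegrable u volume) (k : Fin 3) :
    LocallyIntegrable (fun x => u x k) volume := fun x =>
  (EuclideanSpace.proj k : E3 →L[ℝ] ℝ).integrableAtFilter_comp (hu x)

lemma integrable_component_mul {u : E3 → E3} (hu : LocallyIntegrable u volume) (k : Fin 3)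
    {ψ : E3 → ℝ} (hψ : IsTest ψ) : Integrable (fun x => u x k * ψ x) :=
  integrable_mul_of_hasCompactSupport (locallyIntegrable_component hu k) hψ.continuous hψ.compact

/-- The vector identity `-Δ v = curl curl v - ∇ div v` in weak form, for divergence free `v`. -/
lemma integral_mul_lap {v w : E3 → E3} (hv : LocallyIntegrable v volume) (hd : WeakDivFree v)
    (hw : HasWeakCurl v w) {φ : E3 → ℝ} (hφ : IsTest φ) (i : Fin 3) :
    ∫ x, v x i * lap φ x =
      ∫ x, (w x (i + 2) * pd (i + 1) φ x - w x (i + 1) * pd (i + 2) φ x) := by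
  -- The two curl equations produce `∂ᵢ₊₁² φ` and `∂ᵢ₊₂² φ` against `vᵢ`, plus mixed terms. The
  -- divergence equation tested with `∂ᵢ φ` cancels the mixed terms and supplies `∂ᵢ² φ`.
  have e1 := hw.eq _ (hφ.pd (i + 1)) (i + 2)
  have e2 := hw.eq _ (hφ.pd (i + 2)) (i + 1)
  have e3 := hd _ (hφ.pd i)
  rw [show i + 2 + 1 = i by fin_cases i <;> rfl, show i + 2 + 2 = i + 1 by fin_cases i <;> rfl] at e1
  rw [show i + 1 + 2 = i by fin_cases i <;> rfl, show i + 1 + 1 = i + 2 by fin_cases i <;> rfl] at e2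
  have i1 := fun k j l => integrable_component_mul hv k ((hφ.pd j).pd l)
  rw [integral_sub (integrable_component_mul hw.locInt _ (hφ.pd _))
    (integrable_component_mul hw.locInt _ (hφ.pd _)), ← e1, ← e2]
  have hS : Integrable (fun x => ∑ j, v x j * pd j (pd i φ) x) :=
    integrable_finsetSum _ fun j _ => i1 j i j
  have hA : Integrable (fun x => v x i * pd (i + 1) (pd (i + 1) φ) x -
      v x (i + 1) * pd i (pd (i + 1) φ) x) := (i1 _ _ _).sub (i1 _ _ _)
  have hB : Integrable (fun x => v x (i + 2) * pd i (pd (i + 2) φ) x -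
      v x i * pd (i + 2) (pd (i + 2) φ) x) := (i1 _ _ _).sub (i1 _ _ _)
  rw [← integral_sub hA hB, ← add_zero (∫ x, (_ - _ - (_ - _))), ← e3]
  refine Eq.trans ?_ (integral_add (hA.sub hB) hS)
  congr 1
  ext x
  have hc := pd_pd_comm hφ.smooth
  have hsum : ∀ F : Fin 3 → ℝ, ∑ j, F j = F i + F (i + 1) + F (i + 2) := by
    intro F
    fin_cases i <;> simp [Fin.sum_univ_three] <;> ring
  rw [lap, hsum, hsum, hc (i + 1) i, hc (i + 2) i]
  dsimp only
  ring


/-! ### The `L^{6/5} → L²` bound by an energy estimate -/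

lemma norm_sq_le_sum_apply_single (L : E3 →L[ℝ] ℝ) :
    ‖L‖ ^ 2 ≤ ∑ j, (L (EuclideanSpace.single j 1)) ^ 2 := by
  have h : ‖L‖ ≤ Real.sqrt (∑ j, (L (EuclideanSpace.single j 1)) ^ 2) := by
    refine L.opNorm_le_bound (Real.sqrt_nonneg _) fun x => ?_
    have hx : L x = ∑ j, L (EuclideanSpace.single j 1) * x j := by
      conv_lhs => rw [← (EuclideanSpace.basisFun (Fin 3) ℝ).sum_repr x]
      simp [mul_comm]
    rw [hx, EuclideanSpace.norm_eq, ← Real.sqrt_mul (Finset.sum_nonneg fun _ _ => sq_nonneg _)]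
    refine Real.abs_le_sqrt ?_
    simpa using Finset.sum_mul_sq_le_sq_mul_sq Finset.univ
      (fun j => L (EuclideanSpace.single j 1)) (fun j => x j)
  calc ‖L‖ ^ 2 ≤ Real.sqrt (∑ j, (L (EuclideanSpace.single j 1)) ^ 2) ^ 2 := by gcongr
    _ = _ := Real.sq_sqrt (Finset.sum_nonneg fun _ _ => sq_nonneg _)

/-- Green's identity `∫ |∇u|² = - ∫ u Δu` as an upper bound for the Dirichlet energy. -/
lemma eLpNorm_fderiv_sq_le {u : E3 → ℝ} (hu : IsTest u) :
    eLpNorm (fderiv ℝ u) 2 volume ^ 2 ≤ ∫⁻ x, ‖u x‖ₑ * ‖lap u x‖ₑ := by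
  have hint : ∀ {f g : E3 → ℝ}, IsTest f → IsTest g → Integrable (fun x => f x * g x) :=
    fun hf hg => integrable_mul_of_hasCompactSupport hf.continuous.locallyIntegrable
      hg.continuous hg.compact
  have hparts : ∀ j, ∫ x, pd j u x ^ 2 = - ∫ x, u x * pd j (pd j u) x := by
    intro j
    have := integral_mul_fderiv_eq_neg_fderiv_mul_of_integrable (μ := (volume : Measure E3))
      (f := u) (g := pd j u) (v := EuclideanSpace.single j 1)
      (hint (hu.pd j) (hu.pd j)) (hint hu ((hu.pd j).pd j)) (hint hu (hu.pd j))
      (fun x _ => hu.smooth.differentiable (by simp) x)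
      (fun x _ => (hu.pd j).smooth.differentiable (by simp) x)
    unfold pd at this ⊢
    rw [this, neg_neg]
    simp [sq]
  have hsq : eLpNorm (fderiv ℝ u) 2 volume ^ 2 = ∫⁻ x, ‖fderiv ℝ u x‖ₑ ^ 2 := by
    simpa using eLpNorm_nnreal_pow_eq_lintegral (p := 2) (f := fderiv ℝ u) (μ := volume) (by simp)
  have hsqint : Integrable (fun x => ∑ j, pd j u x ^ 2) := by
    refine integrable_finsetSum _ fun j _ => ?_
    simpa [sq] using hint (hu.pd j) (hu.pd j)
  calc eLpNorm (fderiv ℝ u) 2 volume ^ 2 = ∫⁻ x, ‖fderiv ℝ u x‖ₑ ^ 2 := hsq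
    _ ≤ ∫⁻ x, ENNReal.ofReal (∑ j, pd j u x ^ 2) := by
      refine lintegral_mono fun x => ?_
      rw [← ofReal_norm, ← ENNReal.ofReal_pow (norm_nonneg _)]
      exact ENNReal.ofReal_le_ofReal (norm_sq_le_sum_apply_single _)
    _ = ENNReal.ofReal (∫ x, ∑ j, pd j u x ^ 2) :=
      (ofReal_integral_eq_lintegral_ofReal hsqint
        (ae_of_all _ fun x => Finset.sum_nonneg fun _ _ => sq_nonneg _)).symm
    _ = ENNReal.ofReal (- ∫ x, u x * lap u x) := by
      congr 1
      simp only [lap, Finset.mul_sum]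
      rw [integral_finsetSum _ (fun j _ => hint hu ((hu.pd j).pd j)), integral_finsetSum,
        ← Finset.sum_neg_distrib]
      · exact Finset.sum_congr rfl fun j _ => hparts j
      · intro j _
        simpa [sq] using hint (hu.pd j) (hu.pd j)
    _ ≤ ‖∫ x, u x * lap u x‖ₑ := by
      rw [← ofReal_norm]
      exact ENNReal.ofReal_le_ofReal (neg_le_abs _)
    _ ≤ ∫⁻ x, ‖u x * lap u x‖ₑ := enorm_integral_le_lintegral_enorm _
    _ = _ := by simp [enorm_mul]

/-- Trilinear Young inequality for the pair of conjugate exponents `6/5`, `6`. -/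
lemma lintegral_mul_conv_le {f k u : E3 → ℝ} (hf : AEStronglyMeasurable f volume)
    (hk : Continuous k) (hu : Continuous u) :
    ∫⁻ x, ‖u x‖ₑ * ‖conv f k x‖ₑ ≤
      eLpNorm k 1 volume * (eLpNorm u 6 volume * eLpNorm f (6 / 5) volume) := by
  have hmeas : AEMeasurable (Function.uncurry fun x t : E3 => ‖u x‖ₑ * (‖f (x - t)‖ₑ * ‖k t‖ₑ))
      (volume.prod volume) := by
    have h1 : AEMeasurable (fun p : E3 × E3 => f (p.1 - p.2)) (volume.prod volume) :=
      hf.aemeasurable.comp_quasiMeasurePreserving (quasiMeasurePreserving_sub volume volume)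
    have h2 : Measurable fun p : E3 × E3 => ‖u p.1‖ₑ := (hu.comp continuous_fst).enorm.measurable
    have h3 : Measurable fun p : E3 × E3 => ‖k p.2‖ₑ := (hk.comp continuous_snd).enorm.measurable
    exact h2.aemeasurable.mul (h1.enorm.mul h3.aemeasurable)
  calc ∫⁻ x, ‖u x‖ₑ * ‖conv f k x‖ₑ
      ≤ ∫⁻ x, ∫⁻ t, ‖u x‖ₑ * (‖f (x - t)‖ₑ * ‖k t‖ₑ) := by
        refine lintegral_mono fun x => ?_
        dsimp only
        rw [lintegral_const_mul' _ _ enorm_ne_top, conv_apply_swap]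
        gcongr
        refine (enorm_integral_le_lintegral_enorm _).trans_eq ?_
        simp [enorm_mul]
    _ = ∫⁻ t, ∫⁻ x, ‖u x‖ₑ * (‖f (x - t)‖ₑ * ‖k t‖ₑ) := lintegral_lintegral_swap hmeas
    -- For fixed `t`, Hölder pairs `u` with a translate of `f`, whose norm does not depend on `t`.
    _ ≤ ∫⁻ t, ‖k t‖ₑ * (eLpNorm u 6 volume * eLpNorm f (6 / 5) volume) := by
        refine lintegral_mono fun t => ?_
        have hq := (measurePreserving_sub_right volume t)
        have e : ∀ x, ‖u x‖ₑ * (‖f (x - t)‖ₑ * ‖k t‖ₑ) = ‖k t‖ₑ * (‖u x‖ₑ * ‖f (x - t)‖ₑ) := by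
          intro x; ring
        simp only [e]
        rw [lintegral_const_mul' _ _ enorm_ne_top]
        gcongr
        have hc : Real.HolderConjugate 6 (6 / 5) := by
          rw [Real.holderConjugate_iff]; norm_num
        have hh := ENNReal.lintegral_mul_le_Lp_mul_Lq (volume : Measure E3) hc
          (f := fun x => ‖u x‖ₑ) (g := fun x => ‖f (x - t)‖ₑ) hu.enorm.measurable.aemeasurable
          (hf.comp_measurePreserving hq).enorm
        refine hh.trans_eq ?_
        congr 1
        · rw [eLpNorm_eq_lintegral_rpow_enorm_toReal (by simp) (by simp)]
          simp
        · rw [← eLpNorm_comp_measurePreserving hf hq,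
            eLpNorm_eq_lintegral_rpow_enorm_toReal (by simp) (by simp [ENNReal.div_eq_top])]
          simp
    _ = eLpNorm k 1 volume * (eLpNorm u 6 volume * eLpNorm f (6 / 5) volume) := by
        rw [lintegral_mul_const _ hk.enorm.measurable, eLpNorm_one_eq_lintegral_enorm]

/-- With `u = f * G`, Green, Young and Sobolev give `‖∇u‖₂² ≤ ‖ΔG‖₁ ‖f‖_{6/5} ‖u‖₆ ≤ C ‖ΔG‖₁
‖f‖_{6/5} ‖∇u‖₂`, and one factor `‖∇u‖₂` cancels. Compact support of `f` makes `u` a test function,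
so that this factor is finite. -/
lemma eLpNorm_conv_pd_le_of_hasCompactSupport : ∃ C : ℝ≥0∞, C ≠ ∞ ∧
    ∀ (f G : E3 → ℝ), HasCompactSupport f → LocallyIntegrable f volume → IsTest G →
      MemLp f (6 / 5) volume → ∀ j,
      eLpNorm (conv f (pd j G)) 2 volume ≤
        C * eLpNorm (lap G) 1 volume * eLpNorm f (6 / 5) volume := by
  refine ⟨SNormLESNormFDerivOfEqConst ℝ (volume : Measure E3) 2, by simp, ?_⟩
  intro f G hfc hfl hG hf j
  set C := SNormLESNormFDerivOfEqConst ℝ (volume : Measure E3) 2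
  have hu := isTest_conv hfl hfc hG
  have hs : eLpNorm (conv f G) 6 volume ≤ C * eLpNorm (fderiv ℝ (conv f G)) 2 volume := by
    have := eLpNorm_le_eLpNorm_fderiv_of_eq (volume : Measure E3) (F := ℝ) (u := conv f G) (p := 2)
      (p' := 6) (hu.smooth.of_le (by exact_mod_cast le_top)) hu.compact (by norm_num) (by simp)
      (by simp; norm_num)
    simpa using this
  have hfin : eLpNorm (fderiv ℝ (conv f G)) 2 volume ≠ ∞ :=
    ((hu.smooth.continuous_fderiv (by simp)).memLp_of_hasCompactSupport
      (hu.compact.fderiv ℝ)).eLpNorm_ne_top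
  have h1 : eLpNorm (conv f (pd j G)) 2 volume ≤ eLpNorm (fderiv ℝ (conv f G)) 2 volume := by
    rw [← pd_conv hfl hG]
    refine eLpNorm_mono fun x => ?_
    refine ((fderiv ℝ (conv f G) x).le_opNorm _).trans_eq ?_
    simp
  refine h1.trans ?_
  set A := eLpNorm (fderiv ℝ (conv f G)) 2 volume
  have h2 : A * A ≤ (C * eLpNorm (lap G) 1 volume * eLpNorm f (6 / 5) volume) * A := by
    calc A * A = A ^ 2 := (sq A).symm
      _ ≤ ∫⁻ x, ‖conv f G x‖ₑ * ‖lap (conv f G) x‖ₑ := eLpNorm_fderiv_sq_le hu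
      _ ≤ eLpNorm (lap G) 1 volume * (eLpNorm (conv f G) 6 volume * eLpNorm f (6 / 5) volume) := by
        rw [lap_conv hfl hG]
        exact lintegral_mul_conv_le hf.1 (continuous_lap hG.smooth) hu.continuous
      _ ≤ eLpNorm (lap G) 1 volume * ((C * A) * eLpNorm f (6 / 5) volume) := by gcongr
      _ = _ := by ring
  rcases eq_or_ne A 0 with h0 | h0
  · simp [h0]
  · exact (ENNReal.mul_le_mul_iff_left h0 hfin).1 h2

/-- A Hardy-Littlewood-Sobolev bound: convolution with the gradient of a test function `G` maps
`L^{6/5}` to `L²`, with a norm controlled by the `L¹` norm of the Laplacian of `G`. -/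
lemma eLpNorm_conv_pd_le : ∃ C : ℝ≥0∞, C ≠ ∞ ∧
    ∀ (f G : E3 → ℝ), LocallyIntegrable f volume → IsTest G → MemLp f (6 / 5) volume → ∀ j,
      eLpNorm (conv f (pd j G)) 2 volume ≤
        C * eLpNorm (lap G) 1 volume * eLpNorm f (6 / 5) volume := by
  obtain ⟨C, hC, H⟩ := eLpNorm_conv_pd_le_of_hasCompactSupport
  refine ⟨C, hC, fun f G hfl hG hf j => ?_⟩
  -- Truncating `f` to balls leaves the convolution at each fixed point unchanged for large `n`,
  -- since `∂G` has compact support. Fatou's lemma then removes the truncation.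
  let F : ℕ → E3 → ℝ := fun n => (Metric.closedBall (0 : E3) n).indicator f
  have hFl : ∀ n, LocallyIntegrable (F n) volume := fun n =>
    hfl.indicator Metric.isClosed_closedBall.measurableSet
  have hFc : ∀ n, HasCompactSupport (F n) := fun n =>
    HasCompactSupport.intro (isCompact_closedBall (0 : E3) n) fun x hx => by simp [F, hx]
  have hlim : ∀ x, Tendsto (fun n => conv (F n) (pd j G) x) atTop (𝓝 (conv f (pd j G) x)) := by
    intro x
    obtain ⟨R, hR⟩ := ((hG.pd j).reflect x).compact.isCompact.isBounded.subset_closedBall 0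
    refine tendsto_const_nhds.congr' ?_
    filter_upwards [eventually_ge_atTop ⌈R⌉₊] with n hn
    rw [conv_apply, conv_apply]
    congr 1
    ext t
    by_cases ht : pd j G (x - t) = 0
    · simp [ht]
    · have : t ∈ Metric.closedBall (0 : E3) n :=
        Metric.closedBall_subset_closedBall ((Nat.le_ceil R).trans (by exact_mod_cast hn))
          (hR (subset_tsupport _ ht))
      simp [F, Set.indicator_of_mem this]
  have hmeas : ∀ n, AEStronglyMeasurable (conv (F n) (pd j G)) volume := fun n =>
    (contDiff_conv (hFl n) (hG.pd j)).continuous.aestronglyMeasurable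
  refine (Lp.eLpNorm_lim_le_liminf_eLpNorm hmeas _ (ae_of_all _ hlim)).trans ?_
  refine (liminf_le_liminf (v := fun _ => C * eLpNorm (lap G) 1 volume * eLpNorm f (6 / 5) volume)
    (Eventually.of_forall fun n => ?_)).trans_eq (by simp)
  have hFm : MemLp (F n) (6 / 5) volume := hf.indicator Metric.isClosed_closedBall.measurableSet
  refine (H (F n) G (hFc n) (hFl n) hG hFm j).trans ?_
  gcongr
  exact eLpNorm_indicator_le f


/-! ### A smooth regularisation of the Newtonian kernel -/

/-- The smooth cutoff which vanishes for `s ≤ 1/2` and equals `1` for `s ≥ 1`. -/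
noncomputable def step (s : ℝ) : ℝ := Real.smoothTransition (2 * s - 1)

lemma contDiff_step : ContDiff ℝ (⊤ : ℕ∞) step :=
  Real.smoothTransition.contDiff.comp ((contDiff_const.mul contDiff_id).sub contDiff_const)

lemma step_of_le {s : ℝ} (h : s ≤ 1 / 2) : step s = 0 :=
  Real.smoothTransition.zero_of_nonpos (by linarith)

lemma step_of_ge {s : ℝ} (h : 1 ≤ s) : step s = 1 :=
  Real.smoothTransition.one_of_one_le (by linarith)

lemma monotone_step : Monotone step := fun _ _ h =>
  Real.smoothTransition.monotone (by linarith)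

/-- Minus the derivative of the radial profile, as a function of `|x|²`. -/
noncomputable def slope (s : ℝ) : ℝ := step s * ((Real.sqrt s)⁻¹ * s⁻¹ / 2)

lemma slope_eventuallyEq_zero {s : ℝ} (h : s < 1 / 2) : slope =ᶠ[𝓝 s] fun _ => 0 := by
  filter_upwards [gt_mem_nhds h] with t ht
  simp [slope, step_of_le ht.le]

lemma contDiff_slope : ContDiff ℝ (⊤ : ℕ∞) slope := by
  rw [contDiff_iff_contDiffAt]
  intro s
  rcases lt_or_ge s (1 / 2) with h | h
  · exact contDiffAt_const.congr_of_eventuallyEq (slope_eventuallyEq_zero h)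
  · have h0 : s ≠ 0 := by linarith
    have h1 : Real.sqrt s ≠ 0 := (Real.sqrt_pos.2 (by linarith)).ne'
    exact contDiff_step.contDiffAt.mul
      ((((Real.contDiffAt_sqrt h0).inv h1).mul (contDiffAt_id.inv h0)).div_const 2)

lemma hasDerivAt_inv_sqrt {s : ℝ} (h : 0 < s) :
    HasDerivAt (fun s => (Real.sqrt s)⁻¹) (-((Real.sqrt s)⁻¹ * s⁻¹ / 2)) s := by
  have h1 : Real.sqrt s ≠ 0 := (Real.sqrt_pos.2 h).ne'
  refine ((Real.hasDerivAt_sqrt h.ne').inv h1).congr_deriv ?_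
  rw [Real.sq_sqrt h.le]
  field_simp

/-- At `s = |x|²` the left side is minus the Laplacian of the radial function with profile
derivative `-slope`. Since `1/|x|` is harmonic, the terms with undifferentiated `step` cancel.
Cutting off the derivative of the profile rather than the profile itself is what leaves a term of
known sign. -/
lemma deriv_slope {s : ℝ} (h : 0 < s) :
    6 * slope s + 4 * s * deriv slope s = 2 * deriv step s * (Real.sqrt s)⁻¹ := by
  have h1 := ((hasDerivAt_inv_sqrt h).mul (hasDerivAt_inv h.ne')).div_const 2
  have h2 := ((contDiff_step.differentiable (by simp)) s).hasDerivAt.mul h1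
  have h3 : deriv slope s = _ := h2.deriv
  have h4 : Real.sqrt s ≠ 0 := (Real.sqrt_pos.2 h).ne'
  rw [h3]
  simp only [slope, Pi.mul_apply]
  field_simp
  ring

/-- A smooth radial profile equal to `1 / √t` for `t ≥ 1`. -/
noncomputable def profile (t : ℝ) : ℝ := 1 - ∫ s in (1 : ℝ)..t, slope s

lemma hasDerivAt_profile (t : ℝ) : HasDerivAt profile (-slope t) t := by
  have := (intervalIntegral.integral_hasDerivAt_right
    (contDiff_slope.continuous.intervalIntegrable 1 t)
    contDiff_slope.continuous.stronglyMeasurable.stronglyMeasurableAtFilter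
    contDiff_slope.continuous.continuousAt).const_sub 1
  exact this

lemma contDiff_profile : ContDiff ℝ (⊤ : ℕ∞) profile := by
  rw [contDiff_infty_iff_deriv]
  refine ⟨fun t => (hasDerivAt_profile t).differentiableAt, ?_⟩
  rw [show deriv profile = fun t => -slope t from funext fun t => (hasDerivAt_profile t).deriv]
  exact contDiff_slope.neg

lemma profile_of_ge {t : ℝ} (h : 1 ≤ t) : profile t = (Real.sqrt t)⁻¹ := by
  have key : ∫ s in (1 : ℝ)..t, slope s = -(Real.sqrt t)⁻¹ - -(Real.sqrt 1)⁻¹ := by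
    refine intervalIntegral.integral_eq_sub_of_hasDerivAt (f := fun s => -(Real.sqrt s)⁻¹) ?_
      (contDiff_slope.continuous.intervalIntegrable 1 t)
    intro s hs
    rw [Set.uIcc_of_le h] at hs
    have := (hasDerivAt_inv_sqrt (by linarith [hs.1] : 0 < s)).neg
    refine this.congr_deriv ?_
    simp [slope, step_of_ge hs.1]
  rw [profile, key]
  simp

/-- A smooth function equal to `1 / |x|` for `|x| ≥ 1`. -/
noncomputable def smoothNewton (x : E3) : ℝ := profile (‖x‖ ^ 2)

lemma contDiff_smoothNewton : ContDiff ℝ (⊤ : ℕ∞) smoothNewton :=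
  contDiff_profile.comp (contDiff_norm_sq ℝ)

lemma smoothNewton_of_ge {x : E3} (h : 1 ≤ ‖x‖) : smoothNewton x = ‖x‖⁻¹ := by
  rw [smoothNewton, profile_of_ge (by nlinarith), Real.sqrt_sq (norm_nonneg _)]

lemma pd_comp_norm_sq {F : ℝ → ℝ} (hF : Differentiable ℝ F) (j : Fin 3) (x : E3) :
    pd j (fun y => F (‖y‖ ^ 2)) x = deriv F (‖x‖ ^ 2) * (2 * x j) := by
  have h1 := (hasStrictFDerivAt_norm_sq x).hasFDerivAt
  have h2 := (hF (‖x‖ ^ 2)).hasDerivAt.comp_hasFDerivAt x h1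
  unfold pd
  rw [show (fun y : E3 => F (‖y‖ ^ 2)) = F ∘ fun y => ‖y‖ ^ 2 from rfl, h2.fderiv]
  simp [EuclideanSpace.inner_single_right]

lemma pd_coord (i j : Fin 3) (x : E3) : pd j (fun y => y i) x = if i = j then 1 else 0 := by
  unfold pd
  rw [show (fun y : E3 => y i) = (EuclideanSpace.proj i : E3 →L[ℝ] ℝ) from rfl,
    ContinuousLinearMap.fderiv]
  simp

lemma pd_mul {f g : E3 → ℝ} (hf : Differentiable ℝ f) (hg : Differentiable ℝ g) (j : Fin 3)
    (x : E3) : pd j (fun y => f y * g y) x = f x * pd j g x + g x * pd j f x := by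
  unfold pd
  rw [fderiv_fun_mul (hf x) (hg x)]
  simp

lemma differentiable_coord (i : Fin 3) : Differentiable ℝ (fun y : E3 => y i) :=
  (EuclideanSpace.proj i : E3 →L[ℝ] ℝ).differentiable

lemma lap_smoothNewton (x : E3) : lap smoothNewton x =
    -(6 * slope (‖x‖ ^ 2) + 4 * ‖x‖ ^ 2 * deriv slope (‖x‖ ^ 2)) := by
  have hs : Differentiable ℝ slope := contDiff_slope.differentiable (by simp)
  have h1 : ∀ j, pd j smoothNewton = fun y => slope (‖y‖ ^ 2) * (-2 * y j) := by
    intro j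
    ext y
    have := pd_comp_norm_sq (fun t => (hasDerivAt_profile t).differentiableAt) j y
    rw [(hasDerivAt_profile _).deriv] at this
    exact this.trans (by ring)
  have hds : Differentiable ℝ fun y : E3 => slope (‖y‖ ^ 2) :=
    hs.comp ((contDiff_norm_sq ℝ).differentiable (n := 1) (by simp))
  have h2 : ∀ j, pd j (pd j smoothNewton) x =
      -2 * slope (‖x‖ ^ 2) - 4 * deriv slope (‖x‖ ^ 2) * x j ^ 2 := by
    intro j
    rw [h1, pd_mul hds ((differentiable_coord j).const_mul (-2)), pd_comp_norm_sq hs,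
      pd_mul (differentiable_const (-2)) (differentiable_coord j), pd_coord]
    simp [pd]
    ring
  have hn : ‖x‖ ^ 2 = ∑ j, x j ^ 2 := by
    simp [EuclideanSpace.norm_sq_eq]
  simp only [lap, h2, Finset.sum_sub_distrib, ← Finset.mul_sum, ← hn]
  simp
  ring

lemma lap_smoothNewton_eq_zero {x : E3} (h : 1 < ‖x‖) : lap smoothNewton x = 0 := by
  rw [lap_smoothNewton, deriv_slope (by positivity)]
  have h1 : (1 : ℝ) < ‖x‖ ^ 2 := by nlinarith
  have : step =ᶠ[𝓝 (‖x‖ ^ 2)] fun _ => 1 := by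
    filter_upwards [lt_mem_nhds h1] with t ht using step_of_ge ht.le
  simp [this.deriv_eq]

lemma lap_smoothNewton_nonpos (x : E3) : lap smoothNewton x ≤ 0 := by
  rw [lap_smoothNewton]
  rcases eq_or_ne x 0 with rfl | hx
  · simp [(slope_eventuallyEq_zero (by norm_num : (0 : ℝ) < 1 / 2)).eq_of_nhds]
  · rw [deriv_slope (by positivity)]
    have := monotone_step.deriv_nonneg (x := ‖x‖ ^ 2)
    have : 0 ≤ 2 * deriv step (‖x‖ ^ 2) * (Real.sqrt (‖x‖ ^ 2))⁻¹ := by positivity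
    linarith

lemma integral_lap_smoothNewton_neg : ∫ x, lap smoothNewton x < 0 := by
  -- By the mean value theorem `step` has derivative `2` at some `t` in `(1/2, 1)`, so the Laplacian
  -- is nonzero where `|x|² = t`. Only the sign of the integral is needed, as the kernel is
  -- normalised afterwards.
  obtain ⟨t, ht, hd⟩ := exists_deriv_eq_slope step (by norm_num : (1 / 2 : ℝ) < 1)
    contDiff_step.continuous.continuousOn (contDiff_step.differentiable (by simp)).differentiableOn
  rw [step_of_ge le_rfl, step_of_le le_rfl] at hd
  have ht0 : 0 < t := by linarith [ht.1]
  have hpos : 0 < ∫ x, -lap smoothNewton x := by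
    refine Continuous.integral_pos_of_hasCompactSupport_nonneg_nonzero
      (x := EuclideanSpace.single 0 (Real.sqrt t))
      (continuous_lap contDiff_smoothNewton).neg
      (HasCompactSupport.intro (isCompact_closedBall (0 : E3) 1) fun x hx => ?_)
      (fun x => neg_nonneg.2 (lap_smoothNewton_nonpos x)) ?_
    · rw [lap_smoothNewton_eq_zero (by simpa using hx), neg_zero]
    · rw [lap_smoothNewton, PiLp.norm_single, Real.norm_eq_abs, sq_abs,
        Real.sq_sqrt ht0.le, deriv_slope ht0, hd, neg_neg]
      have := (Real.sqrt_pos.2 ht0).ne'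
      norm_num
      exact this
  rw [integral_neg] at hpos
  linarith

/-- A smoothing of the Newtonian potential near the origin, normalised so that its Laplacian is
minus a mollifier. -/
lemma exists_regularized_kernel : ∃ (h : E3 → ℝ) (a : ℝ), ContDiff ℝ (⊤ : ℕ∞) h ∧
    (∀ x, 1 ≤ ‖x‖ → h x = a * ‖x‖⁻¹) ∧ (∀ x, 1 < ‖x‖ → lap h x = 0) ∧
    ∫ x, lap h x = -1 := by
  set I := ∫ x, lap smoothNewton x
  have hI : I < 0 := integral_lap_smoothNewton_neg
  have hl : ∀ x, lap (fun y => (-I⁻¹) * smoothNewton y) x = -I⁻¹ * lap smoothNewton x := by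
    intro x
    have hc : ∀ (f : E3 → ℝ), Differentiable ℝ f → ∀ j,
        pd j (fun y => (-I⁻¹) * f y) = fun y => -I⁻¹ * pd j f y := by
      intro f hf j
      ext y
      rw [pd_mul (differentiable_const _) hf]
      simp [pd]
    have hs := contDiff_smoothNewton
    unfold lap
    rw [Finset.mul_sum]
    refine Finset.sum_congr rfl fun j _ => ?_
    rw [hc _ (hs.differentiable (by simp)),
      hc _ ((contDiff_pd hs j).differentiable (by simp))]
  refine ⟨fun y => (-I⁻¹) * smoothNewton y, -I⁻¹, contDiff_const.mul contDiff_smoothNewton,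
    fun x hx => by simp only [smoothNewton_of_ge hx],
    fun x hx => by rw [hl, lap_smoothNewton_eq_zero hx, mul_zero], ?_⟩
  simp only [hl]
  rw [integral_const_mul, neg_mul, inv_mul_cancel₀ hI.ne]


/-! ### Mollification at small and large scales -/

/-- The `L¹`-normalised dilation `r⁻³ k(x / r)`. -/
noncomputable def dil (k : E3 → ℝ) (r : ℝ) (x : E3) : ℝ := r⁻¹ ^ 3 * k (r⁻¹ • x)

lemma continuous_dil {k : E3 → ℝ} (hk : Continuous k) (r : ℝ) : Continuous (dil k r) :=
  continuous_const.mul (hk.comp (continuous_const_smul _))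

lemma integral_dil (k : E3 → ℝ) {r : ℝ} (hr : 0 < r) : ∫ x, dil k r x = ∫ x, k x := by
  simp only [dil]
  rw [integral_const_mul, Measure.integral_comp_inv_smul_of_nonneg _ _ hr.le]
  simp
  field_simp

lemma dil_eq_zero {k : E3 → ℝ} (hk0 : ∀ x, 1 < ‖x‖ → k x = 0) {r : ℝ} (hr : 0 < r) {x : E3}
    (hx : r < ‖x‖) : dil k r x = 0 := by
  rw [dil, hk0, mul_zero]
  rw [norm_smul, norm_inv, Real.norm_of_nonneg hr.le, ← div_eq_inv_mul]
  exact (one_lt_div hr).2 hx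

lemma hasCompactSupport_dil {k : E3 → ℝ} (hk0 : ∀ x, 1 < ‖x‖ → k x = 0) {r : ℝ} (hr : 0 < r) :
    HasCompactSupport (dil k r) :=
  HasCompactSupport.intro (isCompact_closedBall (0 : E3) r) fun x hx =>
    dil_eq_zero hk0 hr (by simpa using hx)

lemma abs_dil (k : E3 → ℝ) {r : ℝ} (hr : 0 < r) (x : E3) :
    |dil k r x| = dil (fun y => |k y|) r x := by
  simp [dil, abs_mul, abs_of_pos hr]

lemma exists_bound_of_eq_zero {k : E3 → ℝ} (hk : Continuous k)
    (hk0 : ∀ x, 1 < ‖x‖ → k x = 0) : ∃ M, ∀ x, |k x| ≤ M :=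
  hk.bounded_above_of_compact_support
    (HasCompactSupport.intro (isCompact_closedBall (0 : E3) 1) fun x hx => hk0 x (by simpa using hx))

lemma ae_tendsto_conv_dil {k : E3 → ℝ} (hk : Continuous k) (hk0 : ∀ x, 1 < ‖x‖ → k x = 0)
    (hk1 : ∫ x, k x = 1) {f : E3 → ℝ} (hf : LocallyIntegrable f volume) {ε : ℕ → ℝ}
    (hpos : ∀ n, 0 < ε n) (hε : Tendsto ε atTop (𝓝 0)) :
    ∀ᵐ x, Tendsto (fun n => conv f (dil k (ε n)) x) atTop (𝓝 (f x)) := by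
  obtain ⟨M, hM⟩ := exists_bound_of_eq_zero hk hk0
  filter_upwards [IsUnifLocDoublingMeasure.ae_tendsto_average_norm_sub (μ := volume) hf 1] with x hx
  have hav := hx (l := atTop) (fun _ : ℕ => x) ε
    (tendsto_nhdsWithin_iff.2 ⟨hε, Eventually.of_forall hpos⟩)
    (Eventually.of_forall fun n => Metric.mem_closedBall_self (by simpa using (hpos n).le))
  -- The kernel may change sign: at a Lebesgue point it suffices that `|k_r| ≤ M r⁻³`, which equals
  -- `M |B₁| / |B_r|`.
  have := tendsto_integral_smul_of_tendsto_average_norm_sub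
    (g := fun n t => dil k (ε n) (x - t)) (M * (volume : Measure E3).real (Metric.ball 0 1)) hav
    (Eventually.of_forall fun n => hf.integrableOn_isCompact (isCompact_closedBall _ _)) ?_ ?_ ?_
  · simpa [conv_apply, mul_comm] using this
  · refine tendsto_const_nhds.congr fun n => ?_
    rw [integral_sub_left_eq_self, integral_dil k (hpos n), hk1]
  · refine Eventually.of_forall fun n t ht => ?_
    rw [Metric.mem_closedBall, dist_comm, dist_eq_norm]
    by_contra h
    exact ht (dil_eq_zero hk0 (hpos n) (not_le.1 h))
  · refine Eventually.of_forall fun n t => ?_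
    have hb : (volume : Measure E3).real (Metric.ball 0 1) ≠ 0 :=
      (ENNReal.toReal_pos (Metric.measure_ball_pos _ _ one_pos).ne' measure_ball_lt_top.ne).ne'
    rw [Measure.addHaar_real_closedBall _ _ (hpos n).le, mul_div_mul_right _ _ hb, abs_dil _ (hpos n)]
    simp only [finrank_euclideanSpace_fin, dil]
    rw [div_eq_inv_mul, inv_pow]
    have := hpos n
    gcongr
    exact hM _

/-- The part of `f` below `δ` contributes at most `δ ‖k‖₁` at every scale, while the integrable part
contributes at most `R⁻³ ‖k‖_∞ ‖g‖₁`, which tends to zero. -/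
lemma tendsto_conv_dil_zero {k : E3 → ℝ} (hk : Continuous k) (hk0 : ∀ x, 1 < ‖x‖ → k x = 0)
    {f : E3 → ℝ} (hf : LocallyIntegrable f volume)
    (hv : ∀ δ > 0, ∃ g : E3 → ℝ, Integrable g ∧ ∀ x, |f x| ≤ δ + |g x|) {R : ℕ → ℝ}
    (hpos : ∀ n, 0 < R n) (hR : Tendsto R atTop atTop) (x : E3) :
    Tendsto (fun n => conv f (dil k (R n)) x) atTop (𝓝 0) := by
  obtain ⟨M, hM⟩ := exists_bound_of_eq_zero hk hk0
  set A := ∫ y, |k y|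
  have hA : 0 ≤ A := integral_nonneg fun _ => abs_nonneg _
  have key : ∀ δ > 0, ∃ B, ∀ n, |conv f (dil k (R n)) x| ≤ δ * A + (R n)⁻¹ ^ 3 * B := by
    intro δ hδ
    obtain ⟨g, hg, hfg⟩ := hv δ hδ
    refine ⟨∫ t, |g t| * M, fun n => ?_⟩
    have hr := hpos n
    have hkc := continuous_dil hk (R n)
    have hks := hasCompactSupport_dil hk0 hr
    have hkI : Integrable (fun t => |dil k (R n) (x - t)|) :=
      ((hkc.integrable_of_hasCompactSupport hks).comp_sub_left x).abs
    have hgI : Integrable (fun t => (R n)⁻¹ ^ 3 * (|g t| * M)) :=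
      (hg.abs.mul_const M).const_mul _
    calc |conv f (dil k (R n)) x| ≤ ∫ t, |f t * dil k (R n) (x - t)| := by
          rw [conv_apply]; exact abs_integral_le_integral_abs
      _ ≤ ∫ t, (δ * |dil k (R n) (x - t)| + (R n)⁻¹ ^ 3 * (|g t| * M)) := by
          refine integral_mono (conv_integrand_integrable hf hkc hks x).abs
            ((hkI.const_mul δ).add hgI) fun t => ?_
          have hd : |dil k (R n) (x - t)| ≤ (R n)⁻¹ ^ 3 * M := by
            rw [abs_dil _ hr, dil]
            gcongr
            exact hM _
          dsimp only
          rw [abs_mul]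
          calc |f t| * |dil k (R n) (x - t)| ≤ (δ + |g t|) * |dil k (R n) (x - t)| := by
                gcongr; exact hfg t
            _ = δ * |dil k (R n) (x - t)| + |g t| * |dil k (R n) (x - t)| := by ring
            _ ≤ δ * |dil k (R n) (x - t)| + |g t| * ((R n)⁻¹ ^ 3 * M) := by gcongr
            _ = _ := by ring
      _ = δ * A + (R n)⁻¹ ^ 3 * ∫ t, |g t| * M := by
          rw [integral_add (hkI.const_mul δ) hgI, integral_const_mul, integral_const_mul,
            integral_sub_left_eq_self (fun t => |dil k (R n) t|)]
          simp only [abs_dil k hr]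
          rw [integral_dil _ hr]
  rw [Metric.tendsto_nhds]
  intro e he
  obtain ⟨B, hB⟩ := key (e / 2 / (A + 1)) (by positivity)
  have h0 : Tendsto (fun n => (R n)⁻¹ ^ 3 * B) atTop (𝓝 0) := by
    simpa using ((tendsto_inv_atTop_zero.comp hR).pow 3).mul_const B
  filter_upwards [h0.eventually (gt_mem_nhds (half_pos he))] with n hn
  rw [Real.dist_eq, sub_zero]
  have : e / 2 / (A + 1) * A ≤ e / 2 := by
    rw [div_mul_eq_mul_div, div_le_iff₀ (by positivity)]
    nlinarith
  linarith [hB n]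

/-- The factor `r⁻¹` is the scaling that preserves `a / |x|`, so all rescaled kernels agree far
away. -/
lemma lap_scale {h : E3 → ℝ} (hh : ContDiff ℝ (⊤ : ℕ∞) h) (r : ℝ) (x : E3) :
    lap (fun y => r⁻¹ * h (r⁻¹ • y)) x = dil (lap h) r x := by
  have hc : ∀ (c : ℝ) (f : E3 → ℝ), Differentiable ℝ f → ∀ j,
      pd j (fun y => c * f (r⁻¹ • y)) = fun y => (c * r⁻¹) * pd j f (r⁻¹ • y) := by
    intro c f hf j
    ext y
    have hfc : Differentiable ℝ fun y : E3 => f (r⁻¹ • y) :=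
      hf.comp (differentiable_id.const_smul r⁻¹)
    have := pd_comp_affine hf 0 r⁻¹ j y
    simp only [zero_add] at this
    rw [pd_mul (differentiable_const _) hfc, this]
    simp [pd]
    ring
  simp only [dil, lap, Finset.mul_sum]
  refine Finset.sum_congr rfl fun j _ => ?_
  rw [hc _ _ (hh.differentiable (by simp)),
    hc _ _ ((contDiff_pd hh j).differentiable (by simp))]
  ring

lemma lap_sub {f g : E3 → ℝ} (hf : ContDiff ℝ (⊤ : ℕ∞) f) (hg : ContDiff ℝ (⊤ : ℕ∞) g) (x : E3) :
    lap (fun y => f y - g y) x = lap f x - lap g x := by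
  have hc : ∀ (f g : E3 → ℝ), Differentiable ℝ f → Differentiable ℝ g → ∀ j,
      pd j (fun y => f y - g y) = fun y => pd j f y - pd j g y := by
    intro f g hf hg j
    ext y
    unfold pd
    rw [fderiv_fun_sub (hf y) (hg y)]
    rfl
  simp only [lap, ← Finset.sum_sub_distrib]
  refine Finset.sum_congr rfl fun j _ => ?_
  rw [hc _ _ (hf.differentiable (by simp)) (hg.differentiable (by simp)),
    hc _ _ ((contDiff_pd hf j).differentiable (by simp))
      ((contDiff_pd hg j).differentiable (by simp))]

/-- There is a mollifier `k` such that differences of two of its dilations are Laplacians of test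
functions, with uniformly bounded `L¹` norm. -/
lemma exists_mollifier : ∃ (k : E3 → ℝ) (M : ℝ≥0∞), Continuous k ∧ (∀ x, 1 < ‖x‖ → k x = 0) ∧
    ∫ x, k x = 1 ∧ M ≠ ∞ ∧ ∀ r R : ℝ, 0 < r → 0 < R → ∃ G, IsTest G ∧
      (∀ x, lap G x = dil k R x - dil k r x) ∧ eLpNorm (lap G) 1 volume ≤ M := by
  obtain ⟨h, a, hh, ha, h0, h1⟩ := exists_regularized_kernel
  have hkc : Continuous fun x => -lap h x := (continuous_lap hh).neg
  have hk0 : ∀ x, 1 < ‖x‖ → -lap h x = 0 := fun x hx => by rw [h0 x hx, neg_zero]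
  set k : E3 → ℝ := fun x => -lap h x with hk
  refine ⟨k, 2 * ENNReal.ofReal (∫ x, |k x|), hkc, hk0, by rw [hk, integral_neg, h1, neg_neg],
    by finiteness, fun r R hr hR => ?_⟩
  have hsc : ∀ r : ℝ, ContDiff ℝ (⊤ : ℕ∞) fun y => r⁻¹ * h (r⁻¹ • y) := fun r =>
    contDiff_const.mul (hh.comp (contDiff_id.const_smul r⁻¹))
  have hfar : ∀ r : ℝ, 0 < r → ∀ x : E3, r < ‖x‖ → r⁻¹ * h (r⁻¹ • x) = a * ‖x‖⁻¹ := by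
    intro r hr x hx
    have hn : ‖r⁻¹ • x‖ = r⁻¹ * ‖x‖ := by
      rw [norm_smul, norm_inv, Real.norm_of_nonneg hr.le]
    rw [ha, hn]
    · field_simp
    · rw [hn, ← div_eq_inv_mul]
      exact ((one_lt_div hr).2 hx).le
  have hlap : ∀ x, lap (fun y => r⁻¹ * h (r⁻¹ • y) - R⁻¹ * h (R⁻¹ • y)) x =
      dil k R x - dil k r x := by
    intro x
    rw [lap_sub (hsc r) (hsc R), lap_scale hh, lap_scale hh]
    simp only [dil, hk]
    ring
  -- Outside radius `max r R` both terms equal `a / |x|`, so the difference has compact support. The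
  -- `L¹` bound is uniform because dilation preserves `‖k‖₁`.
  refine ⟨fun y => r⁻¹ * h (r⁻¹ • y) - R⁻¹ * h (R⁻¹ • y), ⟨(hsc r).sub (hsc R), ?_⟩, hlap, ?_⟩
  · refine HasCompactSupport.intro (isCompact_closedBall (0 : E3) (max r R)) fun x hx => ?_
    have hx' : max r R < ‖x‖ := by simpa using hx
    rw [hfar r hr x ((le_max_left _ _).trans_lt hx'),
      hfar R hR x ((le_max_right _ _).trans_lt hx'), sub_self]
  · have hnorm : ∀ s : ℝ, 0 < s → eLpNorm (dil k s) 1 volume = ENNReal.ofReal (∫ x, |k x|) := by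
      intro s hs
      have hi : Integrable (dil k s) := (continuous_dil hkc s).integrable_of_hasCompactSupport
        (hasCompactSupport_dil hk0 hs)
      rw [eLpNorm_one_eq_lintegral_enorm, ← ofReal_integral_norm_eq_lintegral_enorm hi]
      simp only [Real.norm_eq_abs, abs_dil k hs]
      rw [integral_dil _ hs]
    rw [show lap _ = dil k R - dil k r from funext hlap]
    refine (eLpNorm_sub_le (continuous_dil hkc R).aestronglyMeasurable
      (continuous_dil hkc r).aestronglyMeasurable le_rfl).trans_eq ?_
    rw [hnorm R hR, hnorm r hr, two_mul]

/-! ### Square integrability from the curl -/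

/-- This is the weak identity tested with `y ↦ G (x - y)`. Reflection changes the sign of first
derivatives but not of the Laplacian, which reverses the order of the two curl terms. -/
lemma conv_lap_eq {v w : E3 → E3} (hv : LocallyIntegrable v volume) (hd : WeakDivFree v)
    (hw : HasWeakCurl v w) {G : E3 → ℝ} (hG : IsTest G) (i : Fin 3) (x : E3) :
    conv (fun y => v y i) (lap G) x =
      conv (fun y => w y (i + 1)) (pd (i + 2) G) x -
        conv (fun y => w y (i + 2)) (pd (i + 1) G) x := by
  have hw' := fun k => locallyIntegrable_component hw.locInt k
  have h := integral_mul_lap hv hd hw (hG.reflect x) i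
  simp only [lap_reflect hG.smooth, pd_reflect (hG.smooth.differentiable (by simp))] at h
  rw [conv_apply, h, conv_apply, conv_apply, ← integral_sub
    (conv_integrand_integrable (hw' _) (hG.pd _).continuous (hG.pd _).compact x)
    (conv_integrand_integrable (hw' _) (hG.pd _).continuous (hG.pd _).compact x)]
  congr 1
  ext t
  ring

/-- A divergence free field which vanishes at infinity and whose curl lies in `L^{6/5}` is square
integrable. -/
lemma memLp_two_of_curl {v w : E3 → E3} (hv : LocallyIntegrable v volume) (hd : WeakDivFree v)
    (hw : HasWeakCurl v w) (hw65 : MemLp w (6 / 5) volume)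
    (hinf : ∀ δ > 0, ∃ g : E3 → ℝ, Integrable g ∧ ∀ x, ‖v x‖ ≤ δ + |g x|) :
    MemLp v 2 volume := by
  obtain ⟨C, hC, HC⟩ := eLpNorm_conv_pd_le
  obtain ⟨k, M, hk, hk0, hk1, hM, HM⟩ := exists_mollifier
  have hpos1 : ∀ n : ℕ, (0 : ℝ) < 1 / ((n : ℝ) + 1) := fun n => by positivity
  have hpos2 : ∀ n : ℕ, (0 : ℝ) < (n : ℝ) + 1 := fun n => by positivity
  choose G hG hGl hGM using fun n : ℕ => HM (1 / ((n : ℝ) + 1)) ((n : ℝ) + 1) (hpos1 n) (hpos2 n)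
  have hvl := fun j => locallyIntegrable_component hv j
  have hwl := fun j => locallyIntegrable_component hw.locInt j
  have hw65' : ∀ j, MemLp (fun x => w x j) (6 / 5) volume := fun j =>
    (EuclideanSpace.proj j : E3 →L[ℝ] ℝ).comp_memLp' hw65
  have hcomp : ∀ i, MemLp (fun x => v x i) 2 volume := by
    intro i
    refine ⟨(hvl i).aestronglyMeasurable, ?_⟩
    have hcont : ∀ n j l, Continuous (conv (fun y => w y l) (pd j (G n))) := fun n j l =>
      (contDiff_conv (hwl l) ((hG n).pd j)).continuous
    have heq : ∀ n, conv (fun y => v y i) (lap (G n)) =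
        conv (fun y => w y (i + 1)) (pd (i + 2) (G n)) -
          conv (fun y => w y (i + 2)) (pd (i + 1) (G n)) := fun n =>
      funext fun x => conv_lap_eq hv hd hw (hG n) i x
    -- The large scale term tends to `0` by decay at infinity and the small scale term to `v`, so
    -- the difference tends to `-v`.
    have hlim : ∀ᵐ x, Tendsto (fun n => conv (fun y => v y i) (lap (G n)) x) atTop
        (𝓝 (-(v x i))) := by
      have t1 : Tendsto (fun n : ℕ => 1 / ((n : ℝ) + 1)) atTop (𝓝 0) :=
        tendsto_one_div_add_atTop_nhds_zero_nat
      have t2 : Tendsto (fun n : ℕ => (n : ℝ) + 1) atTop atTop :=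
        tendsto_atTop_add_const_right _ _ tendsto_natCast_atTop_atTop
      filter_upwards [ae_tendsto_conv_dil hk hk0 hk1 (hvl i) hpos1 t1] with x hx
      have hx2 := tendsto_conv_dil_zero hk hk0 (hvl i) (fun δ hδ => by
        obtain ⟨g, hg, hb⟩ := hinf δ hδ
        exact ⟨g, hg, fun y => (PiLp.norm_apply_le (v y) i).trans (hb y)⟩) hpos2 t2 x
      have := hx2.sub hx
      rw [zero_sub] at this
      refine this.congr fun n => ?_
      simp only [conv_apply, hGl, mul_sub]
      exact (integral_sub
        (conv_integrand_integrable (hvl i) (continuous_dil hk _)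
          (hasCompactSupport_dil hk0 (hpos2 n)) x)
        (conv_integrand_integrable (hvl i) (continuous_dil hk _)
          (hasCompactSupport_dil hk0 (hpos1 n)) x)).symm
    set B := C * M * eLpNorm (fun x => w x (i + 1)) (6 / 5) volume +
      C * M * eLpNorm (fun x => w x (i + 2)) (6 / 5) volume
    have hbound : ∀ n, eLpNorm (conv (fun y => v y i) (lap (G n))) 2 volume ≤ B := by
      intro n
      rw [heq n]
      refine (eLpNorm_sub_le (hcont _ _ _).aestronglyMeasurable
        (hcont _ _ _).aestronglyMeasurable (by norm_num)).trans ?_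
      refine add_le_add ((HC _ _ (hwl _) (hG n) (hw65' _) _).trans ?_)
        ((HC _ _ (hwl _) (hG n) (hw65' _) _).trans ?_)
      · gcongr; exact hGM n
      · gcongr; exact hGM n
    have hB : B ≠ ∞ := by
      have h1 := (hw65' (i + 1)).eLpNorm_ne_top
      have h2 := (hw65' (i + 2)).eLpNorm_ne_top
      finiteness
    have hmeas : ∀ n, AEStronglyMeasurable (conv (fun y => v y i) (lap (G n))) volume := fun n => by
      rw [heq n]
      exact ((hcont _ _ _).sub (hcont _ _ _)).aestronglyMeasurable
    have hfin : eLpNorm (fun x => -(v x i)) 2 volume ≤ B := by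
      refine (Lp.eLpNorm_lim_le_liminf_eLpNorm hmeas _ hlim).trans ?_
      exact (liminf_le_liminf (v := fun _ => B) (Eventually.of_forall hbound)).trans_eq (by simp)
    rw [show (fun x => -(v x i)) = -(fun x => v x i) from rfl, eLpNorm_neg] at hfin
    exact hfin.trans_lt hB.lt_top
  have hsum : MemLp (fun x => ∑ i, ‖v x i‖) 2 volume := memLp_finsetSum _ fun i _ => (hcomp i).norm
  refine hsum.mono hv.aestronglyMeasurable (ae_of_all _ fun x => ?_)
  rw [Real.norm_of_nonneg (Finset.sum_nonneg fun _ _ => norm_nonneg _), EuclideanSpace.norm_eq]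
  refine Real.sqrt_le_iff.2 ⟨Finset.sum_nonneg fun _ _ => norm_nonneg _, ?_⟩
  exact Finset.sum_sq_le_sq_sum_of_nonneg fun _ _ => norm_nonneg _


/-! ### The Pohozaev identity for finite energy -/

/-- A compactly supported smooth vector field whose Jacobian at the origin is the identity. -/
lemma exists_truncated_position : ∃ Θ : Fin 3 → E3 → ℝ, (∀ i, IsTest (Θ i)) ∧
    (∀ i j, pd j (Θ i) 0 = if i = j then 1 else 0) := by
  let χ : ContDiffBump (0 : E3) := ⟨1, 2, one_pos, one_lt_two⟩
  have hχ : ContDiff ℝ (⊤ : ℕ∞) χ := χ.contDiff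
  refine ⟨fun i y => y i * χ y, fun i => ⟨?_, χ.hasCompactSupport.mul_left⟩, fun i j => ?_⟩
  · exact (EuclideanSpace.proj i : E3 →L[ℝ] ℝ).contDiff.mul hχ
  · rw [pd_mul (differentiable_coord i) (hχ.differentiable (by simp)), pd_coord,
      χ.one_of_mem_closedBall (Metric.mem_closedBall_self zero_le_one)]
    simp

/-- This removes the unknown constant of Bernoulli's law from the tested momentum equation. -/
lemma IsTest.integral_pd_eq_zero {φ : E3 → ℝ} (h : IsTest φ) (i : Fin 3) :
    ∫ x, Beltrami.pd i φ x = 0 := by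
  have := integral_mul_fderiv_eq_neg_fderiv_mul_of_integrable (μ := (volume : Measure E3))
    (f := fun _ => (1 : ℝ)) (g := φ) (v := EuclideanSpace.single i 1) (by simp)
    (by
      have := (h.pd i).continuous.integrable_of_hasCompactSupport (μ := volume) (h.pd i).compact
      unfold Beltrami.pd at this
      simpa using this)
    (by simpa using h.continuous.integrable_of_hasCompactSupport h.compact)
    (fun x _ => differentiableAt_const _) (fun x _ => h.smooth.differentiable (by simp) x)
  simpa [Beltrami.pd] using this

/-- The momentum equation with the pressure eliminated by Bernoulli's law. -/
lemma IsBeltramiSolution.integral_stress {v : E3 → E3} {p lam : E3 → ℝ}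
    (h : IsBeltramiSolution v p lam) {φ : E3 → ℝ} (hφ : IsTest φ) (i : Fin 3) :
    ∫ x, ((∑ j, v x i * v x j * pd j φ x) - ‖v x‖ ^ 2 / 2 * pd i φ x) = 0 := by
  obtain ⟨c, hc⟩ := h.bernoulli
  have hloc : ∀ i j, LocallyIntegrable (fun x => v x i * v x j) volume := by
    intro i j
    refine locallyIntegrable_iff.2 fun K hK => ?_
    have hc := fun i : Fin 3 =>
      (EuclideanSpace.proj i : E3 →L[ℝ] ℝ).comp_memLp' (h.euler.l2loc.loc K hK)
    exact (hc i).integrable_mul (hc j)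
  have hS : Integrable (fun x => ∑ j, v x i * v x j * pd j φ x) := integrable_finsetSum _ fun j _ =>
    integrable_mul_of_hasCompactSupport (hloc i j) (hφ.pd j).continuous (hφ.pd j).compact
  have hP : Integrable (fun x => p x * pd i φ x) :=
    integrable_mul_of_hasCompactSupport h.euler.p_locInt (hφ.pd i).continuous (hφ.pd i).compact
  have hD : Integrable (fun x => c * pd i φ x) :=
    ((hφ.pd i).continuous.integrable_of_hasCompactSupport (hφ.pd i).compact).const_mul c
  have e : (fun x => (∑ j, v x i * v x j * pd j φ x) - ‖v x‖ ^ 2 / 2 * pd i φ x) =ᵐ[volume]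
      fun x => ((∑ j, v x i * v x j * pd j φ x) + p x * pd i φ x) - c * pd i φ x := by
    filter_upwards [hc] with x hx
    rw [← hx]
    ring
  rw [integral_congr_ae e]
  refine (integral_sub (hS.add hP) hD).trans ?_
  rw [integral_const_mul, hφ.integral_pd_eq_zero, mul_zero, sub_zero]
  exact h.euler.momentum φ hφ i

/-- Pohozaev-type argument: a Beltrami solution of finite energy vanishes. -/
theorem IsBeltramiSolution.ae_eq_zero_of_memLp_two {v : E3 → E3} {p lam : E3 → ℝ}
    (h : IsBeltramiSolution v p lam) (hv : MemLp v 2 volume) : v =ᵐ[volume] 0 := by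
  obtain ⟨Θ, hΘ, hΘ0⟩ := exists_truncated_position
  have hsq : Integrable (fun x => ‖v x‖ ^ 2) := (memLp_two_iff_integrable_sq_norm hv.1).1 hv
  choose M hM using fun (q : Fin 3 × Fin 3) =>
    ((hΘ q.1).pd q.2).continuous.bounded_above_of_compact_support ((hΘ q.1).pd q.2).compact
  have hcoord : ∀ x i, |v x i| ≤ ‖v x‖ := fun x i => PiLp.norm_apply_le (v x) i
  have hterm : ∀ x i j m, |v x i * v x j * m| ≤ ‖v x‖ ^ 2 * |m| := by
    intro x i j m
    rw [abs_mul, abs_mul, sq]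
    gcongr <;> exact hcoord _ _
  have hvi : ∀ i, AEStronglyMeasurable (fun x => v x i) volume := fun i =>
    (EuclideanSpace.proj i : E3 →L[ℝ] ℝ).continuous.comp_aestronglyMeasurable hv.1
  have hInt : ∀ (i j : Fin 3) (m : E3 → ℝ), Continuous m → (∃ B, ∀ x, ‖m x‖ ≤ B) →
      Integrable (fun x => v x i * v x j * m x) := by
    rintro i j m hm ⟨B, hB⟩
    refine (hsq.mul_const B).mono' (((hvi i).mul (hvi j)).mul hm.aestronglyMeasurable)
      (ae_of_all _ fun x => (hterm x i j (m x)).trans ?_)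
    gcongr
    exact hB x
  -- This is the Jacobian of `(n+1) Θ(x/(n+1))`, a compactly supported approximation of the position
  -- field. It is bounded uniformly in `n` and tends pointwise to the identity, so `|v|²` times a
  -- constant dominates.
  let m : ℕ → Fin 3 → Fin 3 → E3 → ℝ := fun n i j x => pd j (Θ i) (((n : ℝ) + 1)⁻¹ • x)
  have hmc : ∀ n i j, Continuous (m n i j) := fun n i j =>
    ((hΘ i).pd j).continuous.comp (continuous_const_smul _)
  have hzero : ∀ n i, ∫ x, ((∑ j, v x i * v x j * m n i j x) - ‖v x‖ ^ 2 / 2 * m n i i x) = 0 := by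
    intro n i
    have hr : ((n : ℝ) + 1)⁻¹ ≠ 0 := by positivity
    have ht : IsTest (fun y => Θ i (0 + ((n : ℝ) + 1)⁻¹ • y)) := by
      simp only [zero_add]
      exact ⟨(hΘ i).smooth.comp (contDiff_id.const_smul _),
        (hΘ i).compact.comp_homeomorph (Homeomorph.smulOfNeZero _ hr)⟩
    have := h.integral_stress ht i
    have hp : ∀ j x, pd j (fun y => Θ i (0 + ((n : ℝ) + 1)⁻¹ • y)) x =
        ((n : ℝ) + 1)⁻¹ * pd j (Θ i) (((n : ℝ) + 1)⁻¹ • x) := fun j x => by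
      rw [pd_comp_affine ((hΘ i).smooth.differentiable (by simp)), zero_add]
    simp only [hp] at this
    have e : ∀ x, (∑ j, v x i * v x j * (((n : ℝ) + 1)⁻¹ * pd j (Θ i) (((n : ℝ) + 1)⁻¹ • x))) -
        ‖v x‖ ^ 2 / 2 * (((n : ℝ) + 1)⁻¹ * pd i (Θ i) (((n : ℝ) + 1)⁻¹ • x)) =
        ((n : ℝ) + 1)⁻¹ * ((∑ j, v x i * v x j * m n i j x) - ‖v x‖ ^ 2 / 2 * m n i i x) := by
      intro x
      simp only [m, mul_sub, Finset.mul_sum]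
      congr 1
      · exact Finset.sum_congr rfl fun j _ => by ring
      · ring
    rw [integral_congr_ae (ae_of_all _ e), integral_const_mul] at this
    exact (mul_eq_zero.1 this).resolve_left hr
  have hlim : ∀ i, Tendsto (fun n => ∫ x, ((∑ j, v x i * v x j * m n i j x) -
      ‖v x‖ ^ 2 / 2 * m n i i x)) atTop (𝓝 (∫ x, (v x i ^ 2 - ‖v x‖ ^ 2 / 2))) := by
    intro i
    refine tendsto_integral_of_dominated_convergence
      (fun x => (∑ j, ‖v x‖ ^ 2 * M (i, j)) + ‖v x‖ ^ 2 / 2 * M (i, i)) ?_ ?_ ?_ ?_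
    · intro n
      refine (Finset.aestronglyMeasurable_fun_sum _ fun j _ => ?_).sub ?_
      · exact ((hvi i).mul (hvi j)).mul (hmc n i j).aestronglyMeasurable
      · exact (hsq.div_const 2).1.mul (hmc n i i).aestronglyMeasurable
    · exact (integrable_finsetSum _ fun j _ => hsq.mul_const _).add ((hsq.div_const 2).mul_const _)
    · intro n
      refine ae_of_all _ fun x => ?_
      rw [Real.norm_eq_abs]
      refine (abs_sub _ _).trans (add_le_add ((Finset.abs_sum_le_sum_abs _ _).trans
        (Finset.sum_le_sum fun j _ => (hterm x i j _).trans ?_)) ?_)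
      · gcongr
        exact hM (i, j) _
      · rw [abs_mul, abs_of_nonneg (by positivity : 0 ≤ ‖v x‖ ^ 2 / 2)]
        gcongr
        exact hM (i, i) _
    · refine ae_of_all _ fun x => ?_
      have hm : ∀ j, Tendsto (fun n => m n i j x) atTop (𝓝 (if i = j then 1 else 0)) := by
        intro j
        have h1 : Tendsto (fun n : ℕ => ((n : ℝ) + 1)⁻¹ • x) atTop (𝓝 0) := by
          simpa [one_div] using
            (tendsto_one_div_add_atTop_nhds_zero_nat (𝕜 := ℝ)).smul_const x
        rw [← hΘ0 i j]
        exact (((hΘ i).pd j).continuous.tendsto 0).comp h1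
      have := (tendsto_finsetSum Finset.univ fun j _ => (hm j).const_mul (v x i * v x j)).sub
        ((hm i).const_mul (‖v x‖ ^ 2 / 2))
      simpa [sq] using this
  have hval : ∀ i, ∫ x, (v x i ^ 2 - ‖v x‖ ^ 2 / 2) = 0 := fun i =>
    tendsto_nhds_unique (hlim i) (tendsto_const_nhds.congr fun n => (hzero n i).symm)
  have hii : ∀ i, Integrable (fun x => v x i ^ 2 - ‖v x‖ ^ 2 / 2) := fun i => by
    have := hInt i i (fun _ => 1) continuous_const ⟨1, by simp⟩
    refine Integrable.sub ?_ (hsq.div_const 2)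
    simpa [sq] using this
  have htot : ∫ x, ‖v x‖ ^ 2 = 0 := by
    -- The trace is `|v|² - (3/2) |v|² = -|v|²/2`; in dimension two it would vanish.
    have e : ∀ x, ‖v x‖ ^ 2 = -2 * ∑ i, (v x i ^ 2 - ‖v x‖ ^ 2 / 2) := by
      intro x
      have hn : ‖v x‖ ^ 2 = ∑ j, v x j ^ 2 := by simp [EuclideanSpace.norm_sq_eq]
      rw [Finset.sum_sub_distrib, ← hn]
      simp
      ring
    rw [integral_congr_ae (ae_of_all _ e), integral_const_mul, integral_finsetSum _ fun i _ => hii i]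
    simp [hval]
  have := (integral_eq_zero_iff_of_nonneg (fun x => sq_nonneg ‖v x‖) hsq).1 htot
  filter_upwards [this] with x hx
  simpa using hx

/-! ### Exponents and decay for the condition on the factor -/

/-- For finite `q` the reciprocals add up as `(5q - 6)/(6q) + 6/(6q) = 5/6`. The truncated
subtraction is exact because `5q ≥ 6`, and at `q = 6/5` the first term is `0`. -/
lemma holderTriple_factorExponent {q : ℝ≥0∞} (hq : 6 / 5 ≤ q) :
    ENNReal.HolderTriple (factorExponent q) q (6 / 5) := by
  refine ⟨?_⟩
  rcases eq_or_ne q ∞ with rfl | hq'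
  · simp [factorExponent]
  have h0 : q ≠ 0 := (lt_of_lt_of_le (by simp) hq).ne'
  have h6 : (6 : ℝ≥0∞) ≤ 5 * q := by
    rwa [ENNReal.div_le_iff' (by simp) (by simp)] at hq
  have e : q⁻¹ = 6 / (6 * q) := by
    rw [← one_div, ← ENNReal.mul_div_mul_left 1 q (c := 6) (by simp) (by simp), mul_one]
  rw [factorExponent, if_neg hq', ENNReal.inv_div (Or.inr (by finiteness)) (Or.inr (by simp [h0])),
    ENNReal.inv_div (by simp) (by simp), e, ← ENNReal.add_div, tsub_add_cancel_of_le h6,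
    ENNReal.mul_div_mul_right _ _ h0 hq']

/-- Take `g` to be `|v|` on `{|v| > δ}`. This set has finite measure, by Chebyshev for `q < ∞` and
by assumption for `q = ∞`, and on it `L^q` embeds in `L¹`. -/
lemma exists_integrable_bound {v : E3 → E3} {q : ℝ≥0∞} (hq : 6 / 5 ≤ q) (hv : MemLp v q volume)
    (hinf : q = ∞ → VanishesAtInfinity v) :
    ∀ δ > 0, ∃ g : E3 → ℝ, Integrable g ∧ ∀ x, ‖v x‖ ≤ δ + |g x| := by
  intro δ hδ
  have h1 : (1 : ℝ≥0∞) ≤ q := by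
    refine le_trans ?_ hq
    rw [ENNReal.le_div_iff_mul_le (by simp) (by simp)]
    norm_num
  have hfin : volume {x | δ < ‖v x‖} < ∞ := by
    rcases eq_or_ne q ∞ with h | h
    · exact hinf h δ hδ
    · refine lt_of_le_of_lt (measure_mono fun x hx => ?_)
        (hv.meas_ge_lt_top (by positivity) h (ε := ⟨δ, hδ.le⟩) (by
          exact fun h0 => hδ.ne' (congrArg Subtype.val h0)))
      exact (show δ < ‖v x‖ from hx).le
  have hmeas : NullMeasurableSet {x | δ < ‖v x‖} volume :=
    nullMeasurableSet_lt aemeasurable_const hv.1.norm.aemeasurable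
  have : IsFiniteMeasure (volume.restrict {x | δ < ‖v x‖}) := isFiniteMeasure_restrict.2 hfin.ne
  refine ⟨{x | δ < ‖v x‖}.indicator fun x => ‖v x‖, IntegrableOn.integrable_indicator₀
    (memLp_one_iff_integrable.1 ((hv.restrict _).mono_exponent h1)).norm hmeas, fun x => ?_⟩
  by_cases hx : δ < ‖v x‖
  · rw [Set.indicator_of_mem (by exact hx), abs_norm]
    linarith
  · exact (not_lt.1 hx).trans (le_add_of_nonneg_right (abs_nonneg _))

end Beltrami

theorem theorem1p2 (v : Beltrami.E3 → Beltrami.E3) (p lam : Beltrami.E3 → ℝ)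
    (h : Beltrami.IsBeltramiSolution v p lam) :
    (MemLp v 2 volume → v =ᵐ[volume] 0) ∧
    (∀ q : ℝ≥0∞, 6 / 5 ≤ q →
      MemLp v q volume →
      MemLp lam (Beltrami.factorExponent q) volume →
      (q = ∞ → Beltrami.VanishesAtInfinity v) →
      v =ᵐ[volume] 0) := by
  refine ⟨h.ae_eq_zero_of_memLp_two, fun q hq hv hl hinf => h.ae_eq_zero_of_memLp_two ?_⟩
  have := Beltrami.holderTriple_factorExponent hq
  have h1 : (1 : ℝ≥0∞) ≤ 6 / 5 := by
    rw [ENNReal.le_div_iff_mul_le (by simp) (by simp)]; norm_num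
  exact Beltrami.memLp_two_of_curl (hv.locallyIntegrable (h1.trans hq)) h.euler.div_free h.curl_eq
    (hv.smul hl) (Beltrami.exists_integrable_bound hq hv hinf)
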